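/- There is a universal constant $c>0$ such that the following holds for all integers $M\ge 1$, $K\ge 2$ and $T\ge K$. Setting. A $K$-armed bandit instance $\nu$ consists of reward distributions $\mathcal P_1,\dots,\mathcal P_K$ on $[0,1]$ with means $\mu(1),\dots,\mu(K)$. There are $M$ agents and a server, who do not know $\nu$. In each time step $t=1,\dots,T$ every agent $i$ pulls an arm $a_{t,i}$ and observes a reward $r_{t,i}$ drawn independently from $\mathcal P_{a_{t,i}}$. Before the pulls of each time step the agents and the server may exchange messages without latency, in any number of rounds; a message is a finite sequence of packets, each of which is one integer or one real number. Messages and arms are chosen by a (randomized, measurable) protocol, which may depend on $M,K,T$, on the basis of what the party in question has observed and received so far and of random bits, which may be public. The communication cost of a run is the total number of packets sent between the server and the agents, in either direction. The total regret of a run is $$REG(T)=\sum_{t=1}^{T}\sum_{i=1}^{M}\Bigl(\max_{k}\mu(k)-\mu(a_{t,i})\Bigr).$$ Theorem. For every protocol whose expected communication cost is less than $M/3000$ on every instance, there is an instance on which its expected total regret satisfies $$\mathbb E[REG(T)]\ \ge\ c\,M\sqrt{KT}.$$ Equivalently, a protocol whose expected total regret is less than $cM\sqrt{KT}$ on every instance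 must have expected communication cost at least $M/3000$ on some instance. -/

import Mathlib

open MeasureTheory
open scoped ENNReal

universe u

namespace DistMAB

/-- A packet carries one integer or one real number. -/
abbrev Packet : Type := ℤ ⊕ ℝ

/-- A message is a finite (possibly empty) sequence of packets; its first component is
the number of packets, hence its communication cost. -/
abbrev Msg : Type := Σ n : ℕ, (Fin n → Packet)

/-- The empty message: nothing is sent. -/
def silence : Msg := ⟨0, Fin.elim0⟩

/-- A stochastic `K`-armed bandit instance: one reward distribution on `[0, 1]` per arm. -/
structure Bandit (K : ℕ) where
  law : Fin K → Measure ℝ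
  isProb : ∀ k, IsProbabilityMeasure (law k)
  supported : ∀ k, law k (Set.Icc (0 : ℝ) 1)ᶜ = 0

/-- The mean reward of an arm. -/
noncomputable def Bandit.mean {K : ℕ} (ν : Bandit K) (k : Fin K) : ℝ := ∫ x, x ∂(ν.law k)

/-- The mean reward of a best arm. -/
noncomputable def Bandit.best {K : ℕ} (ν : Bandit K) : ℝ := ⨆ k, ν.mean k

/-- A randomized communication protocol for `M` agents and one server on a `K`-armed bandit with
horizon `T`.

Time step `t` consists of a communication phase, after which every agent pulls one arm. There is no
latency, so a phase may contain any number of rounds `n = 0, 1, 2, …` (rounds that are not needed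
are silent). In a round every agent first sends a message to the server, and then the server sends
a message to every agent.

All parties share a random seed, which is free of charge; private random bits are the special case
in which a party ignores the parts of the seed that do not belong to it. Apart from the seed,

* an agent knows the rewards that it has received and the messages that the server has sent to it
  (its own earlier arms and messages are functions of these and of the seed);
* the server knows the messages that the agents have sent to it.

The functions below receive these data as full records in which all entries that lie in the future
are blank (reward `0`, message `silence`). -/
structure Protocol (M K T : ℕ) where
  Seed : Type u
  seedSpace : MeasurableSpace Seed
  seedLaw : Measure Seed
  seedProb : IsProbabilityMeasure seedLaw
  /-- The message of an agent to the server in round `n` of phase `t`. -/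
  up : Fin T → ℕ → Fin M → Seed × (Fin T → ℝ) × (Fin T → ℕ → Msg) → Msg
  /-- The message of the server to an agent in round `n` of phase `t`. -/
  down : Fin T → ℕ → Fin M → Seed × (Fin T → ℕ → Fin M → Msg) → Msg
  /-- The arm that an agent pulls in time step `t`. -/
  arm : Fin T → Fin M → Seed × (Fin T → ℝ) × (Fin T → ℕ → Msg) → Fin K
  measurable_up : ∀ t n i, Measurable (up t n i)
  measurable_down : ∀ t n i, Measurable (down t n i)
  measurable_arm : ∀ t i, Measurable (arm t i)

attribute [instance] Bandit.isProb Protocol.seedSpace Protocol.seedProb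

/-- What has happened so far: the rewards `reward t i` and the messages `up t n i` (to the server)
and `down t n i` (from the server) of agent `i`. Entries that lie in the future are blank. -/
structure Record (M T : ℕ) where
  reward : Fin T → Fin M → ℝ
  up : Fin T → ℕ → Fin M → Msg
  down : Fin T → ℕ → Fin M → Msg

/-- The record at the very beginning. -/
def Record.blank (M T : ℕ) : Record M T where
  reward := fun _ _ => 0
  up := fun _ _ _ => silence
  down := fun _ _ _ => silence

/-- What agent `i` sees of the record. -/
def Record.view {M T : ℕ} (H : Record M T) (i : Fin M) : (Fin T → ℝ) × (Fin T → ℕ → Msg) :=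
  (fun t => H.reward t i, fun t n => H.down t n i)

namespace Protocol

variable {M K T : ℕ} (P : Protocol.{u} M K T)

/-- Round `n` of phase `t`: all agents send, then the server sends. -/
def round (s : P.Seed) (t : Fin T) (n : ℕ) (H : Record M T) : Record M T :=
  let newUp : Fin T → ℕ → Fin M → Msg :=
    Function.update H.up t (Function.update (H.up t) n fun i => P.up t n i (s, H.view i))
  let newDown : Fin T → ℕ → Fin M → Msg :=
    Function.update H.down t (Function.update (H.down t) n fun i => P.down t n i (s, newUp))
  { reward := H.reward, up := newUp, down := newDown }

/-- The record after the first `n` rounds of phase `t`, if `H` is the record before the phase. -/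
def rounds (s : P.Seed) (t : Fin T) (H : Record M T) : ℕ → Record M T
  | 0 => H
  | n + 1 => P.round s t n (rounds s t H n)

/-- The record after all rounds of phase `t`, if `H` is the record before the phase. -/
def phase (s : P.Seed) (t : Fin T) (H : Record M T) : Record M T where
  reward := H.reward
  up := Function.update H.up t fun n => (P.rounds s t H (n + 1)).up t n
  down := Function.update H.down t fun n => (P.rounds s t H (n + 1)).down t n

/-- All agents pull an arm in step `t`, if `H` is the record after phase `t`. Here `Y (t, i, k)` is
the reward that agent `i` receives in step `t` if it pulls arm `k`. -/
def pull (s : P.Seed) (Y : Fin T × Fin M × Fin K → ℝ) (t : Fin T) (H : Record M T) :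
    Record M T where
  reward := Function.update H.reward t fun i => Y (t, i, P.arm t i (s, H.view i))
  up := H.up
  down := H.down

/-- The record before time step `t`. -/
def before (s : P.Seed) (Y : Fin T × Fin M × Fin K → ℝ) : ℕ → Record M T
  | 0 => Record.blank M T
  | t + 1 =>
    if h : t < T then P.pull s Y ⟨t, h⟩ (P.phase s ⟨t, h⟩ (before s Y t))
    else before s Y t

/-- The record after communication phase `t` and before the pulls of step `t`. -/
def afterPhase (s : P.Seed) (Y : Fin T × Fin M × Fin K → ℝ) (t : Fin T) : Record M T :=
  P.phase s t (P.before s Y t)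

/-- The arm that agent `i` pulls in time step `t`. -/
def action (s : P.Seed) (Y : Fin T × Fin M × Fin K → ℝ) (t : Fin T) (i : Fin M) : Fin K :=
  P.arm t i (s, (P.afterPhase s Y t).view i)

/-- The communication cost of a run: the total number of packets sent between the server and the
agents, in either direction. -/
noncomputable def cost (s : P.Seed) (Y : Fin T × Fin M × Fin K → ℝ) : ℝ≥0∞ :=
  ∑ t : Fin T, ∑' n : ℕ, ∑ i : Fin M,
    ((((P.afterPhase s Y t).up t n i).1 : ℝ≥0∞) + (((P.afterPhase s Y t).down t n i).1 : ℝ≥0∞))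

/-- The total regret of a run. -/
noncomputable def regret (ν : Bandit K) (s : P.Seed) (Y : Fin T × Fin M × Fin K → ℝ) : ℝ :=
  ∑ t : Fin T, ∑ i : Fin M, (ν.best - ν.mean (P.action s Y t i))

/-- The probability space of a run on the instance `ν`: the seed is independent of the potential
rewards `Y (t, i, k)`, which are independent with `Y (t, i, k)` distributed as the reward of
arm `k`. -/
noncomputable def runLaw (ν : Bandit K) :
    Measure (P.Seed × (Fin T × Fin M × Fin K → ℝ)) :=
  P.seedLaw.prod (Measure.pi fun x : Fin T × Fin M × Fin K => ν.law x.2.2)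

/-- The expected communication cost on the instance `ν`. -/
noncomputable def expectedCost (ν : Bandit K) : ℝ≥0∞ :=
  ∫⁻ ω, P.cost ω.1 ω.2 ∂(P.runLaw ν)

/-- The expected total regret on the instance `ν`. -/
noncomputable def expectedRegret (ν : Bandit K) : ℝ :=
  ∫ ω, P.regret ν ω.1 ω.2 ∂(P.runLaw ν)

end Protocol

end DistMAB

/-! An agent that never receives a packet sees only the seed and its own rewards, so it plays
exactly as an isolated bandit player. Every contacted agent costs at least one packet, so the
contact probabilities sum to at most `M / 3000`: on average almost every agent is isolated and pays
the single-player price of order `√(K T)`.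

The hard instances have fair coins on all arms except one, whose bias is `ε ≈ √(K / T)`. For one
player, `le_sum_wrong_pulls` compares each instance with all-fair coins: the L¹ distance is
controlled by `ε ^ 2` times the pulls of the good arm under fair coins, and these pulls sum to `T`
over all positions of the good arm, so for most positions the player cannot find it.

The transfer avoids conditioning on the absence of contact. `lonelyArm` is the policy obtained by
feeding the agent only silence. It agrees with the true actions on every uncontacted run
(`action_of_mem_rewardBox`), and `wrong` adds a penalty `T` on contacted runs, so its expectation
dominates the wrong pulls of the lonely policy. Summing over agents and good arms, the penalties are
too small to account for the bound, and the remainder is regret. -/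

namespace DistMAB

/-! ### Single-player lower bound on the finite space of coin sequences. -/

section FiniteLowerBound

variable {T K : ℕ}

/-- The likelihood ratio, relative to fair coin flips, of the reward sequence `r` of a policy `a`
if arm `k` yields reward `1` with probability `1 / 2 + ε` and all other arms are fair. -/
noncomputable def likelihood (ε : ℝ) (a : (Fin T → Bool) → Fin T → Fin K) (k : Fin K)
    (r : Fin T → Bool) : ℝ :=
  ∏ t, (1 + if a r t = k then (if r t then 2 * ε else -(2 * ε)) else 0)

/-- The number of pulls of arm `k` by the policy `a` along the reward sequence `r`. -/
noncomputable def pulls (a : (Fin T → Bool) → Fin T → Fin K) (k : Fin K)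
    (r : Fin T → Bool) : ℝ :=
  ∑ t, if a r t = k then 1 else 0

lemma sum_pulls (a : (Fin T → Bool) → Fin T → Fin K) (r : Fin T → Bool) :
    ∑ k, pulls a k r = T := by
  unfold pulls
  rw [Finset.sum_comm]
  simp

lemma pulls_nonneg (a : (Fin T → Bool) → Fin T → Fin K) (k : Fin K) (r : Fin T → Bool) :
    0 ≤ pulls a k r :=
  Finset.sum_nonneg fun t _ => by split_ifs <;> norm_num

lemma pulls_le (a : (Fin T → Bool) → Fin T → Fin K) (k : Fin K) (r : Fin T → Bool) :
    pulls a k r ≤ T := by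
  calc pulls a k r ≤ ∑ _t : Fin T, (1 : ℝ) :=
        Finset.sum_le_sum fun t _ => by split_ifs <;> norm_num
    _ = T := by simp

lemma likelihood_factor_pos {ε : ℝ} (h0 : 0 ≤ ε) (h1 : ε ≤ 1 / 4)
    (a : (Fin T → Bool) → Fin T → Fin K) (k : Fin K) (r : Fin T → Bool) (t : Fin T) :
    0 < (1 + if a r t = k then (if r t then 2 * ε else -(2 * ε)) else 0 : ℝ) := by
  split_ifs <;> linarith

lemma likelihood_pos {ε : ℝ} (h0 : 0 ≤ ε) (h1 : ε ≤ 1 / 4)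
    (a : (Fin T → Bool) → Fin T → Fin K) (k : Fin K) (r : Fin T → Bool) :
    0 < likelihood ε a k r :=
  Finset.prod_pos fun t _ => likelihood_factor_pos h0 h1 a k r t

/-- Replacing a summand by its average over the two values of one coordinate. -/
lemma two_mul_sum_eq_sum_flip (t : Fin T) (g : (Fin T → Bool) → ℝ) :
    2 * ∑ r, g r = ∑ r, (g r + g (Function.update r t (!r t))) := by
  have hinv : Function.Involutive fun r : Fin T → Bool => Function.update r t (!r t) := by
    intro r
    simp
  have h := Equiv.sum_comp hinv.toPerm g
  simp only [Function.Involutive.coe_toPerm] at h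
  rw [Finset.sum_add_distrib, h]
  ring

/-- Flipping coin `t` leaves the arm at time `t` unchanged, so pairing each sequence with its flip
averages the two possible log factors. This is the divergence decomposition: information is gained
only by pulling arm `k`. -/
lemma sum_log_likelihood {ε : ℝ} (h0 : 0 ≤ ε) (h1 : ε ≤ 1 / 4)
    (a : (Fin T → Bool) → Fin T → Fin K)
    (ha : ∀ r t b, a (Function.update r t b) t = a r t) (k : Fin K) :
    2 * ∑ r, Real.log (likelihood ε a k r)
      = (∑ r, pulls a k r) * (Real.log (1 + 2 * ε) + Real.log (1 - 2 * ε)) := by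
  have hlog : ∀ r, Real.log (likelihood ε a k r)
      = ∑ t, Real.log (1 + if a r t = k then (if r t then 2 * ε else -(2 * ε)) else 0) :=
    fun r => Real.log_prod fun t _ => (likelihood_factor_pos h0 h1 a k r t).ne'
  simp_rw [hlog, pulls, Finset.sum_mul]
  rw [Finset.sum_comm, Finset.mul_sum, Finset.sum_comm (s := Finset.univ (α := Fin T → Bool))]
  refine Finset.sum_congr rfl fun t _ => ?_
  rw [two_mul_sum_eq_sum_flip t]
  refine Finset.sum_congr rfl fun r _ => ?_
  rw [ha]
  by_cases h : a r t = k
  · cases hr : r t <;> simp [h, sub_eq_add_neg, add_comm]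
  · simp [h]

/-- A linear substitute for Pinsker's inequality: without a square root, the bounds can be summed
over arms directly. With `x = √L`, `(x - 1) ^ 2 ≤ L - 1 - log L` follows from `log x ≤ x - 1`, and
AM-GM is applied to `|x - 1| * (x + 1)`. -/
lemma abs_sub_one_le_of_pos {L : ℝ} (hL : 0 < L) :
    |L - 1| ≤ 8 * (L - 1 - Real.log L) + (L + 1) / 16 := by
  have hs : 0 < √L := Real.sqrt_pos.2 hL
  have hsq : √L ^ 2 = L := Real.sq_sqrt hL.le
  have hlog : Real.log L = 2 * Real.log (√L) := by
    rw [Real.log_sqrt hL.le]; ring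
  have h := Real.log_le_sub_one_of_pos hs
  rw [abs_le]
  constructor
  · nlinarith [sq_nonneg (16 * (√L - 1) + (√L + 1)), sq_nonneg (√L - 1)]
  · nlinarith [sq_nonneg (16 * (√L - 1) - (√L + 1)), sq_nonneg (√L - 1)]

lemma neg_log_add_log_le {ε : ℝ} (h0 : 0 ≤ ε) (h1 : ε ≤ 1 / 4) :
    -(Real.log (1 + 2 * ε) + Real.log (1 - 2 * ε)) ≤ 6 * ε ^ 2 := by
  rw [← Real.log_mul (by linarith) (by linarith)]
  have hpos : 0 < (1 + 2 * ε) * (1 - 2 * ε) := by nlinarith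
  have h := Real.one_sub_inv_le_log_of_pos hpos
  have h2 : ((1 + 2 * ε) * (1 - 2 * ε))⁻¹ ≤ 1 + 6 * ε ^ 2 := by
    rw [inv_le_iff_one_le_mul₀ hpos]
    have : ε ^ 2 ≤ 1 / 16 := by nlinarith
    nlinarith [sq_nonneg ε]
  linarith

lemma sum_abs_likelihood_sub_one_le {ε : ℝ} (h0 : 0 ≤ ε) (h1 : ε ≤ 1 / 4)
    (a : (Fin T → Bool) → Fin T → Fin K)
    (ha : ∀ r t b, a (Function.update r t b) t = a r t) (k : Fin K)
    (hsum : ∑ r, likelihood ε a k r ≤ 2 ^ T) :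
    ∑ r, |likelihood ε a k r - 1| ≤ 24 * ε ^ 2 * ∑ r, pulls a k r + 2 ^ T / 8 := by
  have hcard : ∑ _r : Fin T → Bool, (1 : ℝ) = 2 ^ T := by simp
  have h := Finset.sum_le_sum fun r (_ : r ∈ Finset.univ) =>
    abs_sub_one_le_of_pos (likelihood_pos h0 h1 a k r)
  rw [Finset.sum_add_distrib, ← Finset.mul_sum, ← Finset.sum_div, Finset.sum_sub_distrib,
    Finset.sum_sub_distrib, Finset.sum_add_distrib, hcard] at h
  have hl := sum_log_likelihood h0 h1 a ha k
  have hN : 0 ≤ ∑ r, pulls a k r := Finset.sum_nonneg fun r _ => pulls_nonneg a k r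
  have := mul_le_mul_of_nonneg_left (neg_log_add_log_le h0 h1) hN
  nlinarith

/-- The minimax lower bound for a single agent: averaged over the position of the good arm, a
constant fraction of the pulls is wrong. -/
theorem le_sum_wrong_pulls (hK : 2 ≤ K) {ε : ℝ} (h0 : 0 ≤ ε) (h1 : ε ≤ 1 / 4)
    (hε : 256 * (ε ^ 2 * T) ≤ K)
    (a : (Fin T → Bool) → Fin T → Fin K)
    (ha : ∀ r t b, a (Function.update r t b) t = a r t)
    (hsum : ∀ k, ∑ r, likelihood ε a k r ≤ 2 ^ T) :
    (K : ℝ) * T / 4 ≤ ∑ k, ∑ r, likelihood ε a k r / 2 ^ T * (T - pulls a k r) := by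
  have hcard : ∑ _r : Fin T → Bool, (1 : ℝ) = 2 ^ T := by simp
  have h2 : (0 : ℝ) < 2 ^ T := by positivity
  have hT : (0 : ℝ) ≤ T := Nat.cast_nonneg T
  have hKr : (2 : ℝ) ≤ K := by exact_mod_cast hK
  have hk : ∀ k, 2 ^ T * T - ∑ r, pulls a k r
      - T * (24 * ε ^ 2 * ∑ r, pulls a k r + 2 ^ T / 8)
      ≤ ∑ r, likelihood ε a k r * (T - pulls a k r) := by
    intro k
    -- The change of measure costs at most `T * |L - 1|`, since `T - pulls` lies in `[0, T]`.
    have hp : ∀ r, (1 : ℝ) * T - pulls a k r - T * |likelihood ε a k r - 1|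
        ≤ likelihood ε a k r * (T - pulls a k r) := by
      intro r
      have hN0 := pulls_nonneg a k r
      have hN1 := pulls_le a k r
      have habs := neg_abs_le (likelihood ε a k r - 1)
      have habs0 := abs_nonneg (likelihood ε a k r - 1)
      nlinarith [mul_le_mul_of_nonneg_right habs (sub_nonneg.2 hN1)]
    have h := Finset.sum_le_sum fun r (_ : r ∈ Finset.univ) => hp r
    rw [Finset.sum_sub_distrib, Finset.sum_sub_distrib, ← Finset.sum_mul, hcard,
      ← Finset.mul_sum] at h
    have h' := mul_le_mul_of_nonneg_left
      (sum_abs_likelihood_sub_one_le h0 h1 a ha k (hsum k)) hT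
    linarith
  have hN : ∑ k, ∑ r, pulls a k r = 2 ^ T * T := by
    rw [Finset.sum_comm]
    simp_rw [sum_pulls]
    simp
  have hs := Finset.sum_le_sum fun k (_ : k ∈ Finset.univ) => hk k
  have hN' : ∑ k : Fin K, (T : ℝ) * (24 * ε ^ 2 * ∑ r, pulls a k r + 2 ^ T / 8)
      = T * (24 * ε ^ 2 * (2 ^ T * T) + K * (2 ^ T / 8)) := by
    rw [← Finset.mul_sum, Finset.sum_add_distrib, ← Finset.mul_sum, hN]
    simp
  rw [Finset.sum_sub_distrib, Finset.sum_sub_distrib, hN, hN'] at hs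
  simp only [Finset.sum_const, Finset.card_univ, Fintype.card_fin, nsmul_eq_mul] at hs
  have hdiv : ∑ k, ∑ r, likelihood ε a k r / 2 ^ T * (T - pulls a k r)
      = (∑ k, ∑ r, likelihood ε a k r * (T - pulls a k r)) / 2 ^ T := by
    simp_rw [Finset.sum_div]
    exact Finset.sum_congr rfl fun k _ => Finset.sum_congr rfl fun r _ => by ring
  rw [hdiv, le_div_iff₀ h2]
  refine le_trans ?_ hs
  have hz : 0 ≤ (2 : ℝ) ^ T * T := by positivity
  -- Of `K * T`, the losses are at most `1/2` (total pulls, as `K ≥ 2`), `24/256` (divergence) and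
  -- `1/8`; this leaves `9/32 ≥ 1/4`.
  nlinarith [mul_le_mul_of_nonneg_left hε hz, mul_le_mul_of_nonneg_left hKr hz]

end FiniteLowerBound

/-! ### Measurability of the run. -/

/-- A random record all of whose components are measurable. -/
structure MeasurableRecord {M T : ℕ} {Ω : Type*} [MeasurableSpace Ω] (H : Ω → Record M T) :
    Prop where
  reward : Measurable fun ω => (H ω).reward
  up : Measurable fun ω => (H ω).up
  down : Measurable fun ω => (H ω).down

lemma measurable_update_const {ι Ω : Type*} {β : ι → Type*} [DecidableEq ι] [MeasurableSpace Ω]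
    [∀ j, MeasurableSpace (β j)] {f : Ω → ∀ j, β j} (hf : Measurable f) (j : ι)
    {g : Ω → β j} (hg : Measurable g) : Measurable fun ω => Function.update (f ω) j (g ω) := by
  refine measurable_pi_iff.2 fun j' => ?_
  by_cases h : j' = j
  · subst h
    simpa using hg
  · simpa [h, Function.comp_def] using (measurable_pi_apply j').comp hf

lemma MeasurableRecord.view {M T : ℕ} {Ω : Type*} [MeasurableSpace Ω] {H : Ω → Record M T}
    (hH : MeasurableRecord H) (i : Fin M) : Measurable fun ω => (H ω).view i := by
  have h1 := hH.reward
  have h2 := hH.down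
  unfold Record.view
  fun_prop

namespace Protocol

variable {M K T : ℕ} (P : Protocol.{u} M K T)

section Measurability

variable {Ω : Type*} [MeasurableSpace Ω] {s : Ω → P.Seed} {Y : Ω → Fin T × Fin M × Fin K → ℝ}

lemma measurable_round (hs : Measurable s) (t : Fin T) (n : ℕ) {H : Ω → Record M T}
    (hH : MeasurableRecord H) : MeasurableRecord fun ω => P.round (s ω) t n (H ω) := by
  have hup : Measurable fun ω => (P.round (s ω) t n (H ω)).up := by
    refine measurable_update_const hH.up t (measurable_update_const (by have := hH.up; fun_prop) n
      (measurable_pi_iff.2 fun i => (P.measurable_up t n i).comp (hs.prodMk (hH.view i))))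
  refine ⟨hH.reward, hup, ?_⟩
  exact measurable_update_const hH.down t
    (measurable_update_const (by have := hH.down; fun_prop) n
      (measurable_pi_iff.2 fun i => (P.measurable_down t n i).comp (hs.prodMk hup)))

lemma measurable_rounds (hs : Measurable s) (t : Fin T) {H : Ω → Record M T}
    (hH : MeasurableRecord H) (n : ℕ) : MeasurableRecord fun ω => P.rounds (s ω) t (H ω) n := by
  induction n with
  | zero => exact hH
  | succ n ih => exact P.measurable_round hs t n ih

lemma measurable_phase (hs : Measurable s) (t : Fin T) {H : Ω → Record M T}
    (hH : MeasurableRecord H) : MeasurableRecord fun ω => P.phase (s ω) t (H ω) := by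
  refine ⟨hH.reward, ?_, ?_⟩
  · refine measurable_update_const hH.up t (measurable_pi_iff.2 fun n => ?_)
    have := (P.measurable_rounds hs t hH (n + 1)).up
    fun_prop
  · refine measurable_update_const hH.down t (measurable_pi_iff.2 fun n => ?_)
    have := (P.measurable_rounds hs t hH (n + 1)).down
    fun_prop

lemma measurable_comp_index {ι Ω : Type*} [Finite ι] [MeasurableSpace ι] [MeasurableSingletonClass ι]
    [MeasurableSpace Ω] {f : Ω → ι → ℝ} (hf : Measurable f) {g : Ω → ι} (hg : Measurable g) :
    Measurable fun ω => f ω (g ω) :=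
  (measurable_from_prod_countable_left
    (f := fun p : (ι → ℝ) × ι => p.1 p.2) fun j => measurable_pi_apply j).comp (hf.prodMk hg)

lemma measurable_pull (hs : Measurable s) (hY : Measurable Y) (t : Fin T) {H : Ω → Record M T}
    (hH : MeasurableRecord H) : MeasurableRecord fun ω => P.pull (s ω) (Y ω) t (H ω) := by
  refine ⟨?_, hH.up, hH.down⟩
  refine measurable_update_const hH.reward t (measurable_pi_iff.2 fun i => ?_)
  exact measurable_comp_index (f := fun ω k => Y ω (t, i, k)) (by fun_prop)
    ((P.measurable_arm t i).comp (hs.prodMk (hH.view i)))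

lemma measurable_before (hs : Measurable s) (hY : Measurable Y) (m : ℕ) :
    MeasurableRecord fun ω => P.before (s ω) (Y ω) m := by
  induction m with
  | zero => exact ⟨measurable_const, measurable_const, measurable_const⟩
  | succ m ih =>
    by_cases h : m < T
    · simp only [before, h, dif_pos]
      exact P.measurable_pull hs hY _ (P.measurable_phase hs _ ih)
    · simpa only [before, h, dif_neg, not_false_eq_true] using ih

lemma measurable_afterPhase (hs : Measurable s) (hY : Measurable Y) (t : Fin T) :
    MeasurableRecord fun ω => P.afterPhase (s ω) (Y ω) t :=
  P.measurable_phase hs t (P.measurable_before hs hY t)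

lemma measurable_action (hs : Measurable s) (hY : Measurable Y) (t : Fin T) (i : Fin M) :
    Measurable fun ω => P.action (s ω) (Y ω) t i :=
  (P.measurable_arm t i).comp (hs.prodMk ((P.measurable_afterPhase hs hY t).view i))

end Measurability

/-! ### What an uncontacted agent sees, and the price of contact. -/

section Views

variable (s : P.Seed) (Y : Fin T × Fin M × Fin K → ℝ)

lemma before_reward (m : ℕ) (t : Fin T) (i : Fin M) :
    (P.before s Y m).reward t i = if (t : ℕ) < m then Y (t, i, P.action s Y t i) else 0 := by
  induction m with
  | zero => rfl
  | succ m ih =>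
    by_cases h : m < T
    · simp only [before, h, dif_pos, pull, phase]
      by_cases ht : t = ⟨m, h⟩
      · subst ht
        simp [action, afterPhase, phase]
      · have : (t : ℕ) ≠ m := fun h' => ht (Fin.ext h')
        have h2 : (t : ℕ) < m + 1 ↔ (t : ℕ) < m := by omega
        simp [ht, ih, h2]
    · have h2 : (t : ℕ) < m + 1 ↔ (t : ℕ) < m := by omega
      simp only [before, h, dif_neg, not_false_eq_true, ih, h2]

lemma before_down (m : ℕ) (t : Fin T) :
    (P.before s Y m).down t
      = if (t : ℕ) < m then (P.afterPhase s Y t).down t else fun _ _ => silence := by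
  induction m with
  | zero => rfl
  | succ m ih =>
    by_cases h : m < T
    · simp only [before, h, dif_pos, pull]
      by_cases ht : t = ⟨m, h⟩
      · subst ht
        simp [afterPhase]
      · have : (t : ℕ) ≠ m := fun h' => ht (Fin.ext h')
        have h2 : (t : ℕ) < m + 1 ↔ (t : ℕ) < m := by omega
        simp [phase, ht, ih, h2]
    · have h2 : (t : ℕ) < m + 1 ↔ (t : ℕ) < m := by omega
      simp only [before, h, dif_neg, not_false_eq_true, ih, h2]

/-- Agent `i` receives at least one packet from the server. -/
def Contacted (i : Fin M) : Prop :=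
  ∃ (t : Fin T) (n : ℕ), ((P.afterPhase s Y t).down t n i).1 ≠ 0

lemma eq_silence_of_length_eq_zero {m : Msg} (h : m.1 = 0) : m = silence := by
  obtain ⟨n, f⟩ := m
  obtain rfl : n = 0 := h
  exact congrArg _ (Subsingleton.elim _ _)

/-- An agent that is not contacted sees only its own rewards. -/
lemma view_of_not_contacted {i : Fin M} (h : ¬ P.Contacted s Y i) (t : Fin T) :
    (P.afterPhase s Y t).view i
      = (fun t' => if t' < t then Y (t', i, P.action s Y t' i) else 0,
          fun _ _ => silence) := by
  simp only [Contacted, not_exists, not_not] at h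
  refine Prod.ext ?_ ?_
  · funext t'
    exact P.before_reward s Y t t' i
  · funext t' n
    change (P.afterPhase s Y t).down t' n i = silence
    by_cases ht : t' = t
    · subst ht
      exact eq_silence_of_length_eq_zero (h t' n)
    · have : (P.afterPhase s Y t).down t' = (P.before s Y t).down t' := by
        simp [afterPhase, phase, ht]
      rw [this, before_down]
      split_ifs
      · exact eq_silence_of_length_eq_zero (h t' n)
      · rfl

-- A contact uses at least one downward packet, which is charged to the agent that receives it;
-- upward packets are discarded.
open Classical in
lemma sum_contacted_le_cost :
    ∑ i, (if P.Contacted s Y i then (1 : ℝ≥0∞) else 0) ≤ P.cost s Y := by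
  have hcost : P.cost s Y = ∑ i : Fin M, ∑ t : Fin T, ∑' n : ℕ,
      ((((P.afterPhase s Y t).up t n i).1 : ℝ≥0∞)
        + (((P.afterPhase s Y t).down t n i).1 : ℝ≥0∞)) := by
    unfold cost
    rw [Finset.sum_comm]
    exact Finset.sum_congr rfl fun t _ =>
      Summable.tsum_finsetSum fun i _ => ENNReal.summable
  rw [hcost]
  refine Finset.sum_le_sum fun i _ => ?_
  split_ifs with h
  · obtain ⟨t, n, hn⟩ := h
    refine le_trans ?_ (Finset.single_le_sum (fun _ _ => zero_le) (Finset.mem_univ t))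
    refine le_trans ?_ (ENNReal.le_tsum n)
    refine le_trans ?_ le_add_self
    exact_mod_cast Nat.one_le_iff_ne_zero.2 hn
  · exact zero_le

end Views

lemma measurableSet_contacted (i : Fin M) :
    MeasurableSet {ω : P.Seed × (Fin T × Fin M × Fin K → ℝ) | P.Contacted ω.1 ω.2 i} := by
  simp only [Contacted, Set.ofPred_exists]
  refine MeasurableSet.iUnion fun t => MeasurableSet.iUnion fun n => ?_
  have hlen : Measurable fun m : Msg => m.1 := by
    intro A _
    -- The σ-algebra of a sigma type is tested fibre by fibre, and the length is constant on each
    -- fibre.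
    refine MeasurableSpace.measurableSet_iInf.2 fun n => ?_
    change MeasurableSet {_f : Fin n → Packet | n ∈ A}
    exact MeasurableSet.const _
  have hd := (P.measurable_afterPhase measurable_fst measurable_snd t).down
  have : Measurable fun ω : P.Seed × (Fin T × Fin M × Fin K → ℝ) =>
      ((P.afterPhase ω.1 ω.2 t).down t n i).1 := hlen.comp (by fun_prop)
  exact this (measurableSet_singleton 0).compl

end Protocol

/-! ### The hard instances. -/

section Bernoulli

/-- The Bernoulli distribution with success probability `p` as a measure on `ℝ`. -/
noncomputable def bernoulliLaw (p : ℝ) : Measure ℝ :=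
  ENNReal.ofReal (1 - p) • Measure.dirac 0 + ENNReal.ofReal p • Measure.dirac 1

/-- The reward that encodes an outcome of a coin flip. -/
def coinReward (b : Bool) : ℝ := if b then 1 else 0

lemma coinReward_injective : Function.Injective coinReward := by
  intro b b' h
  cases b <;> cases b' <;> simp_all [coinReward]

lemma isProbabilityMeasure_bernoulliLaw {p : ℝ} (h0 : 0 ≤ p) (h1 : p ≤ 1) :
    IsProbabilityMeasure (bernoulliLaw p) := by
  constructor
  simp only [bernoulliLaw, Measure.coe_add, Measure.coe_smul, Pi.add_apply, Pi.smul_apply,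
    measure_univ, smul_eq_mul, mul_one]
  rw [← ENNReal.ofReal_add (by linarith) h0]
  simp

lemma integral_bernoulliLaw {p : ℝ} (h0 : 0 ≤ p) : ∫ x, x ∂(bernoulliLaw p) = p := by
  unfold bernoulliLaw
  rw [integral_add_measure, integral_smul_measure, integral_smul_measure]
  · simp [h0]
  · exact (integrable_dirac (by simp)).smul_measure (by simp)
  · exact (integrable_dirac (by simp)).smul_measure (by simp)

lemma bernoulliLaw_real_singleton {p : ℝ} (h0 : 0 ≤ p) (h1 : p ≤ 1) (b : Bool) :
    (bernoulliLaw p).real {coinReward b} = if b then p else 1 - p := by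
  cases b <;> simp [bernoulliLaw, Measure.real, coinReward, h0, h1]

variable {K : ℕ}

/-- The instance in which arm `k` is a coin of success probability `1 / 2 + ε` and all other arms
are fair coins. -/
noncomputable def coinBandit {ε : ℝ} (h0 : 0 ≤ ε) (h1 : ε ≤ 1 / 4) (k : Fin K) : Bandit K where
  law j := bernoulliLaw (1 / 2 + if j = k then ε else 0)
  isProb j := isProbabilityMeasure_bernoulliLaw (by split_ifs <;> linarith)
    (by split_ifs <;> linarith)
  supported j := by
    simp [bernoulliLaw]

variable {ε : ℝ} (h0 : 0 ≤ ε) (h1 : ε ≤ 1 / 4)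

lemma coinBandit_mean (k j : Fin K) :
    (coinBandit h0 h1 k).mean j = 1 / 2 + if j = k then ε else 0 :=
  integral_bernoulliLaw (by split_ifs <;> linarith)

lemma coinBandit_best (k : Fin K) : (coinBandit h0 h1 k).best = 1 / 2 + ε := by
  have : Nonempty (Fin K) := ⟨k⟩
  unfold Bandit.best
  apply le_antisymm
  · refine ciSup_le fun j => ?_
    rw [coinBandit_mean]
    split_ifs <;> linarith
  · refine le_ciSup_of_le (Set.finite_range _).bddAbove k ?_
    simp [coinBandit_mean]

lemma coinBandit_law_real_singleton (k j : Fin K) (b : Bool) :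
    ((coinBandit h0 h1 k).law j).real {coinReward b}
      = (1 + if j = k then (if b then 2 * ε else -(2 * ε)) else 0) / 2 := by
  change (bernoulliLaw _).real _ = _
  rw [bernoulliLaw_real_singleton (by split_ifs <;> linarith) (by split_ifs <;> linarith)]
  split_ifs <;> ring

end Bernoulli

/-! ### Coupling each agent with its lonely policy. -/

namespace Protocol

variable {M K T : ℕ} (P : Protocol.{u} M K T)

/-- The arms that agent `i` pulls if it receives no messages and the reward sequence `r`. -/
def lonelyArm (s : P.Seed) (i : Fin M) (r : Fin T → Bool) (t : Fin T) : Fin K :=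
  P.arm t i (s, fun t' => if t' < t then coinReward (r t') else 0, fun _ _ => silence)

lemma lonelyArm_congr (s : P.Seed) (i : Fin M) {r r' : Fin T → Bool} {t : Fin T}
    (h : ∀ t' < t, r t' = r' t') : P.lonelyArm s i r t = P.lonelyArm s i r' t := by
  unfold lonelyArm
  congr 3
  funext t'
  split_ifs with ht
  · rw [h t' ht]
  · rfl

lemma lonelyArm_update (s : P.Seed) (i : Fin M) (r : Fin T → Bool) (t : Fin T) (b : Bool) :
    P.lonelyArm s i (Function.update r t b) t = P.lonelyArm s i r t :=
  P.lonelyArm_congr s i fun t' ht => by simp [ht.ne]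

/-- The reward tables for which agent `i`, if it receives no messages, observes the reward
sequence `r`. -/
def rewardBox (s : P.Seed) (i : Fin M) (r : Fin T → Bool) : Set (Fin T × Fin M × Fin K → ℝ) :=
  Set.univ.pi fun x =>
    if x.2.1 = i then (if x.2.2 = P.lonelyArm s i r x.1 then {coinReward (r x.1)} else Set.univ)
    else Set.univ

variable {P} in
lemma apply_of_mem_rewardBox {s : P.Seed} {i : Fin M} {r : Fin T → Bool}
    {Y : Fin T × Fin M × Fin K → ℝ} (h : Y ∈ P.rewardBox s i r) (t : Fin T) :
    Y (t, i, P.lonelyArm s i r t) = coinReward (r t) := by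
  simpa using h (t, i, P.lonelyArm s i r t) (Set.mem_univ _)

lemma measurableSet_rewardBox (s : P.Seed) (i : Fin M) (r : Fin T → Bool) :
    MeasurableSet (P.rewardBox s i r) := by
  refine MeasurableSet.univ_pi fun x => ?_
  split_ifs
  · exact measurableSet_singleton _
  · exact MeasurableSet.univ
  · exact MeasurableSet.univ

-- Strong induction on time: equal pasts give the same lonely arm, hence the same entry of the
-- table. Thus distinct boxes are disjoint.
variable {P} in
lemma eq_of_mem_rewardBox {s : P.Seed} {i : Fin M} {r r' : Fin T → Bool}
    {Y : Fin T × Fin M × Fin K → ℝ} (h : Y ∈ P.rewardBox s i r) (h' : Y ∈ P.rewardBox s i r') :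
    r = r' := by
  funext t
  induction t using WellFoundedLT.induction with
  | ind t ih =>
    have e := apply_of_mem_rewardBox h t
    rw [P.lonelyArm_congr s i ih, apply_of_mem_rewardBox h' t] at e
    exact (coinReward_injective e).symm

/-- The box is a product set that constrains a single coordinate per time step, namely the entry of
the lonely arm; it contributes one likelihood factor over `2`. -/
lemma pi_rewardBox {ε : ℝ} (h0 : 0 ≤ ε) (h1 : ε ≤ 1 / 4) (k : Fin K)
    (s : P.Seed) (i : Fin M) (r : Fin T → Bool) :
    (Measure.pi fun x : Fin T × Fin M × Fin K => (coinBandit h0 h1 k).law x.2.2).real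
      (P.rewardBox s i r) = likelihood ε (P.lonelyArm s i) k r / 2 ^ T := by
  unfold rewardBox
  rw [Measure.real, Measure.pi_pi, ENNReal.toReal_prod, Fintype.prod_prod_type]
  have hfac : ∀ t : Fin T, ∏ y : Fin M × Fin K,
      ((coinBandit h0 h1 k).law y.2 (if y.1 = i then
        (if y.2 = P.lonelyArm s i r t then {coinReward (r t)} else Set.univ) else Set.univ)).toReal
      = (1 + if P.lonelyArm s i r t = k then (if r t then 2 * ε else -(2 * ε)) else 0) / 2 := by
    intro t
    rw [Finset.prod_eq_single (i, P.lonelyArm s i r t)]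
    · simpa [Measure.real] using coinBandit_law_real_singleton h0 h1 k (P.lonelyArm s i r t) (r t)
    · rintro ⟨j, l⟩ - hne
      by_cases hj : j = i
      · have hl : l ≠ P.lonelyArm s i r t := fun hl => hne (by rw [hj, hl])
        simp [hl]
      · simp [hj]
    · simp
  rw [Finset.prod_congr rfl fun t _ => hfac t, Finset.prod_div_distrib]
  simp [likelihood]

/-- The terms, divided by `2 ^ T`, are probabilities of disjoint boxes. -/
lemma sum_likelihood_lonelyArm_le {ε : ℝ} (h0 : 0 ≤ ε) (h1 : ε ≤ 1 / 4) (k : Fin K)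
    (s : P.Seed) (i : Fin M) : ∑ r, likelihood ε (P.lonelyArm s i) k r ≤ 2 ^ T := by
  have h := sum_measureReal_le_measureReal_univ
    (μ := Measure.pi fun x : Fin T × Fin M × Fin K => (coinBandit h0 h1 k).law x.2.2)
    (s := Finset.univ) (t := P.rewardBox s i)
    (fun r _ => P.measurableSet_rewardBox s i r)
    (fun r _ r' _ hne => Set.disjoint_left.2 fun Y hY hY' =>
      hne (eq_of_mem_rewardBox hY hY'))
  simp_rw [P.pi_rewardBox h0 h1 k s i, ← Finset.sum_div, probReal_univ] at h
  rwa [div_le_one (by positivity)] at h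

/-- Induction on time: as long as the actions agree, the observed rewards are those encoded by `r`,
and all messages are silent. -/
lemma action_of_mem_rewardBox {s : P.Seed} {i : Fin M} {r : Fin T → Bool}
    {Y : Fin T × Fin M × Fin K → ℝ} (h : Y ∈ P.rewardBox s i r) (hc : ¬ P.Contacted s Y i)
    (t : Fin T) : P.action s Y t i = P.lonelyArm s i r t := by
  induction t using WellFoundedLT.induction with
  | ind t ih =>
    unfold action lonelyArm
    rw [P.view_of_not_contacted s Y hc t]
    congr 3
    funext t'
    split_ifs with ht
    · rw [ih t' ht, apply_of_mem_rewardBox h]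
    · rfl

open Classical in
/-- The number of time steps in which agent `i` does not pull arm `k`, plus `T` if the agent is
contacted. -/
noncomputable def wrong (k : Fin K) (i : Fin M) (ω : P.Seed × (Fin T × Fin M × Fin K → ℝ)) : ℝ :=
  ∑ t, (if P.action ω.1 ω.2 t i = k then 0 else 1) + T * if P.Contacted ω.1 ω.2 i then 1 else 0

lemma wrong_nonneg (k : Fin K) (i : Fin M) (ω : P.Seed × (Fin T × Fin M × Fin K → ℝ)) :
    0 ≤ P.wrong k i ω :=
  add_nonneg (Finset.sum_nonneg fun t _ => by split_ifs <;> norm_num)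
    (mul_nonneg (Nat.cast_nonneg T) (by split_ifs <;> norm_num))

lemma measurable_indicator_action (k : Fin K) (t : Fin T) (i : Fin M) :
    Measurable fun ω : P.Seed × (Fin T × Fin M × Fin K → ℝ) =>
      if P.action ω.1 ω.2 t i = k then (0 : ℝ) else 1 :=
  Measurable.ite (P.measurable_action measurable_fst measurable_snd t i (measurableSet_singleton k))
    measurable_const measurable_const

open Classical in
lemma measurable_indicator_contacted (i : Fin M) :
    Measurable fun ω : P.Seed × (Fin T × Fin M × Fin K → ℝ) =>
      if P.Contacted ω.1 ω.2 i then (1 : ℝ) else 0 :=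
  Measurable.ite (P.measurableSet_contacted i) measurable_const measurable_const

lemma measurable_wrong (k : Fin K) (i : Fin M) : Measurable (P.wrong k i) := by
  have h1 := P.measurable_indicator_action k (i := i)
  have h2 := P.measurable_indicator_contacted i
  unfold wrong
  fun_prop

lemma wrong_le (k : Fin K) (i : Fin M) (ω : P.Seed × (Fin T × Fin M × Fin K → ℝ)) :
    P.wrong k i ω ≤ 2 * T := by
  classical
  have h1 : ∑ t, (if P.action ω.1 ω.2 t i = k then (0 : ℝ) else 1) ≤ ∑ _t : Fin T, (1 : ℝ) :=
    Finset.sum_le_sum fun t _ => by split_ifs <;> norm_num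
  have h2 : (T : ℝ) * (if P.Contacted ω.1 ω.2 i then 1 else 0) ≤ T * 1 :=
    mul_le_mul_of_nonneg_left (by split_ifs <;> norm_num) (Nat.cast_nonneg T)
  simp only [Finset.sum_const, Finset.card_univ, Fintype.card_fin, nsmul_eq_mul] at h1
  unfold wrong
  linarith

lemma norm_wrong_le (k : Fin K) (i : Fin M) (ω : P.Seed × (Fin T × Fin M × Fin K → ℝ)) :
    ‖P.wrong k i ω‖ ≤ 2 * T := by
  rw [Real.norm_of_nonneg (P.wrong_nonneg k i ω)]
  exact P.wrong_le k i ω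

instance (ν : Bandit K) : IsProbabilityMeasure (P.runLaw ν) := by
  unfold runLaw
  infer_instance

lemma integrable_wrong (ν : Bandit K) (k : Fin K) (i : Fin M) :
    Integrable (P.wrong k i) (P.runLaw ν) :=
  Integrable.of_bound (P.measurable_wrong k i).aestronglyMeasurable (2 * T)
    (ae_of_all _ (P.norm_wrong_le k i))

/-- At most one box contains `Y`. In it, either the agent is uncontacted and both sides count the
same wrong pulls, or the penalty `T` suffices. Outside all boxes the left side vanishes, so the
boxes need not cover the space. -/
lemma sum_indicator_rewardBox_le_wrong (k : Fin K) (i : Fin M) (s : P.Seed)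
    (Y : Fin T × Fin M × Fin K → ℝ) :
    ∑ r, (P.rewardBox s i r).indicator (fun _ => T - pulls (P.lonelyArm s i) k r) Y
      ≤ P.wrong k i (s, Y) := by
  classical
  by_cases h : ∃ r, Y ∈ P.rewardBox s i r
  · obtain ⟨r, hr⟩ := h
    rw [Finset.sum_eq_single r, Set.indicator_of_mem hr]
    · by_cases hc : P.Contacted s Y i
      · have h1 : 0 ≤ ∑ t, (if P.action s Y t i = k then (0 : ℝ) else 1) :=
          Finset.sum_nonneg fun t _ => by split_ifs <;> norm_num
        have h2 := pulls_nonneg (P.lonelyArm s i) k r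
        simp only [wrong, hc, if_true]
        linarith
      · have hT : (T : ℝ) = ∑ _t : Fin T, (1 : ℝ) := by simp
        simp only [wrong, hc, if_false, mul_zero, add_zero, pulls,
          P.action_of_mem_rewardBox hr hc]
        rw [hT, ← Finset.sum_sub_distrib]
        refine Finset.sum_le_sum fun t _ => ?_
        split_ifs <;> norm_num
    · intro r' _ hne
      exact Set.indicator_of_notMem (fun hr' => hne (eq_of_mem_rewardBox hr' hr)) _
    · simp
  · rw [not_exists] at h
    rw [Finset.sum_eq_zero fun r _ => Set.indicator_of_notMem (h r) _]
    exact P.wrong_nonneg k i _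

lemma sum_likelihood_le_integral_wrong {ε : ℝ} (h0 : 0 ≤ ε) (h1 : ε ≤ 1 / 4) (k : Fin K)
    (i : Fin M) (s : P.Seed) :
    ∑ r, likelihood ε (P.lonelyArm s i) k r / 2 ^ T * (T - pulls (P.lonelyArm s i) k r)
      ≤ ∫ Y, P.wrong k i (s, Y)
        ∂(Measure.pi fun x : Fin T × Fin M × Fin K => (coinBandit h0 h1 k).law x.2.2) := by
  set π := Measure.pi fun x : Fin T × Fin M × Fin K => (coinBandit h0 h1 k).law x.2.2 with hπ
  have hint : ∀ r, Integrable ((P.rewardBox s i r).indicator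
      fun _ => T - pulls (P.lonelyArm s i) k r) π := fun r =>
    (integrable_const _).indicator (P.measurableSet_rewardBox s i r)
  have hwrong : Integrable (fun Y => P.wrong k i (s, Y)) π :=
    Integrable.of_bound ((P.measurable_wrong k i).comp measurable_prodMk_left).aestronglyMeasurable
      (2 * T) (ae_of_all _ fun Y => P.norm_wrong_le k i (s, Y))
  have h := integral_mono (integrable_finsetSum _ fun r _ => hint r) hwrong
    (P.sum_indicator_rewardBox_le_wrong k i s)
  rw [integral_finsetSum _ fun r _ => hint r] at h
  simp_rw [integral_indicator_const _ (P.measurableSet_rewardBox s i _), smul_eq_mul, hπ,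
    P.pi_rewardBox h0 h1 k s i] at h
  exact h

/-- Averaged over the position of the good arm, an agent pulls wrong arms in a constant fraction
of the time steps or is contacted. -/
lemma le_sum_integral_wrong (hK : 2 ≤ K) {ε : ℝ} (h0 : 0 ≤ ε) (h1 : ε ≤ 1 / 4)
    (hε : 256 * (ε ^ 2 * T) ≤ K) (i : Fin M) :
    (K : ℝ) * T / 4 ≤ ∑ k, ∫ ω, P.wrong k i ω ∂(P.runLaw (coinBandit h0 h1 k)) := by
  have hprod : ∀ k, ∫ ω, P.wrong k i ω ∂(P.runLaw (coinBandit h0 h1 k))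
      = ∫ s, ∫ Y, P.wrong k i (s, Y)
        ∂(Measure.pi fun x : Fin T × Fin M × Fin K => (coinBandit h0 h1 k).law x.2.2)
        ∂P.seedLaw := fun k => integral_prod _ (P.integrable_wrong _ k i)
  have hint : ∀ k, Integrable (fun s => ∫ Y, P.wrong k i (s, Y)
        ∂(Measure.pi fun x : Fin T × Fin M × Fin K => (coinBandit h0 h1 k).law x.2.2))
        P.seedLaw := fun k =>
    Integrable.integral_prod_left (P.integrable_wrong (coinBandit h0 h1 k) k i)
  -- For a fixed seed the lonely policy is deterministic, so the finite bound applies before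
  -- integrating over the seed.
  simp_rw [hprod]
  rw [← integral_finsetSum _ fun k _ => hint k]
  calc (K : ℝ) * T / 4 = ∫ _s, (K : ℝ) * T / 4 ∂P.seedLaw := by simp
    _ ≤ _ := integral_mono (integrable_const _) (integrable_finsetSum _ fun k _ => hint k)
      fun s => (le_sum_wrong_pulls hK h0 h1 hε (P.lonelyArm s i) (P.lonelyArm_update s i)
          (fun k => P.sum_likelihood_lonelyArm_le h0 h1 k s i)).trans
        (Finset.sum_le_sum fun k _ => P.sum_likelihood_le_integral_wrong h0 h1 k i s)

lemma sum_real_contacted_le (ν : Bandit K) (h : P.expectedCost ν < (M : ℝ≥0∞) / 3000) :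
    ∑ i, (P.runLaw ν).real {ω | P.Contacted ω.1 ω.2 i} ≤ (M : ℝ) / 3000 := by
  classical
  have h1 : ∑ i, P.runLaw ν {ω | P.Contacted ω.1 ω.2 i} ≤ (M : ℝ≥0∞) / 3000 := by
    refine le_trans ?_ h.le
    have : ∀ i, P.runLaw ν {ω | P.Contacted ω.1 ω.2 i}
        = ∫⁻ ω, (if P.Contacted ω.1 ω.2 i then 1 else 0) ∂(P.runLaw ν) := by
      intro i
      rw [← lintegral_indicator_one (P.measurableSet_contacted i)]
      rfl
    simp_rw [this]
    rw [← lintegral_finsetSum _ fun i _ =>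
      Measurable.ite (P.measurableSet_contacted i) measurable_const measurable_const]
    exact lintegral_mono fun ω => P.sum_contacted_le_cost ω.1 ω.2
  have h2 := ENNReal.toReal_mono (ENNReal.div_ne_top (by simp) (by simp)) h1
  rw [ENNReal.toReal_sum fun i _ => measure_ne_top _ _] at h2
  simpa [Measure.real] using h2

lemma regret_coinBandit {ε : ℝ} (h0 : 0 ≤ ε) (h1 : ε ≤ 1 / 4) (k : Fin K)
    (ω : P.Seed × (Fin T × Fin M × Fin K → ℝ)) :
    P.regret (coinBandit h0 h1 k) ω.1 ω.2
      = ε * ∑ i, ∑ t, (if P.action ω.1 ω.2 t i = k then (0 : ℝ) else 1) := by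
  unfold regret
  rw [Finset.sum_comm, Finset.mul_sum]
  refine Finset.sum_congr rfl fun i _ => ?_
  rw [Finset.mul_sum]
  refine Finset.sum_congr rfl fun t _ => ?_
  rw [coinBandit_best, coinBandit_mean]
  split_ifs <;> ring

lemma sum_integral_wrong {ε : ℝ} (h0 : 0 ≤ ε) (h1 : ε ≤ 1 / 4) (k : Fin K) :
    ε * ∑ i, ∫ ω, P.wrong k i ω ∂(P.runLaw (coinBandit h0 h1 k))
      = P.expectedRegret (coinBandit h0 h1 k)
        + ε * (T * ∑ i, (P.runLaw (coinBandit h0 h1 k)).real {ω | P.Contacted ω.1 ω.2 i}) := by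
  classical
  have hA : ∀ i t, Integrable (fun ω => if P.action ω.1 ω.2 t i = k then (0 : ℝ) else 1)
      (P.runLaw (coinBandit h0 h1 k)) := fun i t =>
    Integrable.of_bound (P.measurable_indicator_action k t i).aestronglyMeasurable 1
      (ae_of_all _ fun ω => by split_ifs <;> simp)
  have hC : ∀ i, Integrable (fun ω => (T : ℝ) * if P.Contacted ω.1 ω.2 i then (1 : ℝ) else 0)
      (P.runLaw (coinBandit h0 h1 k)) := fun i =>
    (Integrable.of_bound (P.measurable_indicator_contacted i).aestronglyMeasurable 1
      (ae_of_all _ fun ω => by split_ifs <;> simp)).const_mul _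
  have hCi : ∀ i, ∫ ω, (if P.Contacted ω.1 ω.2 i then (1 : ℝ) else 0)
      ∂(P.runLaw (coinBandit h0 h1 k))
      = (P.runLaw (coinBandit h0 h1 k)).real {ω | P.Contacted ω.1 ω.2 i} := by
    intro i
    rw [← integral_indicator_one (P.measurableSet_contacted i)]
    rfl
  unfold wrong expectedRegret
  simp_rw [regret_coinBandit]
  rw [integral_const_mul, integral_finsetSum _ fun i _ => integrable_finsetSum _ fun t _ => hA i t,
    ← mul_add, Finset.mul_sum (a := (T : ℝ)), ← Finset.sum_add_distrib]
  congr 1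
  refine Finset.sum_congr rfl fun i _ => ?_
  rw [integral_add (integrable_finsetSum _ fun t _ => hA i t) (hC i), integral_const_mul, hCi]

end Protocol

end DistMAB

/-! ### Choice of the gap and averaging over agents and instances. -/

theorem theorem2 :
    ∃ c : ℝ, 0 < c ∧
      ∀ (M K T : ℕ), 2 ≤ K → K ≤ T →
        ∀ P : DistMAB.Protocol.{u} M K T,
          (∀ ν : DistMAB.Bandit K, P.expectedCost ν < (M : ℝ≥0∞) / 3000) →
            ∃ ν : DistMAB.Bandit K,
              c * (M : ℝ) * Real.sqrt ((K : ℝ) * (T : ℝ)) ≤ P.expectedRegret ν := by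
  refine ⟨1 / 128, by norm_num, fun M K T hK hKT P hP => ?_⟩
  have hKr : (2 : ℝ) ≤ K := by exact_mod_cast hK
  have hKTr : (K : ℝ) ≤ T := by exact_mod_cast hKT
  have hT : (0 : ℝ) < T := by linarith
  have hsq : √((K : ℝ) * T) ^ 2 = K * T := Real.sq_sqrt (by positivity)
  have hspos : 0 < √((K : ℝ) * T) := Real.sqrt_pos.2 (by positivity)
  have hsT : √((K : ℝ) * T) ≤ T := by
    rw [Real.sqrt_le_left hT.le]
    nlinarith
  -- The largest gap allowed by `256 * (ε ^ 2 * T) ≤ K`, which becomes an equality; `K ≤ T` gives `ε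
  -- ≤ 1 / 16`.
  obtain ⟨ε, hε⟩ : ∃ ε, ε = √((K : ℝ) * T) / (16 * T) := ⟨_, rfl⟩
  have hεT : ε * T = √((K : ℝ) * T) / 16 := by rw [hε]; field_simp
  have hεpos : 0 < ε := by rw [hε]; positivity
  have h1 : ε ≤ 1 / 4 := by
    rw [hε, div_le_iff₀ (by positivity)]
    linarith
  have hε2 : 256 * (ε ^ 2 * T) ≤ K := by
    have : 256 * (ε ^ 2 * T) * T = K * T := by
      rw [← hsq, show √((K : ℝ) * T) = 16 * (ε * T) by rw [hεT]; ring]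
      ring
    exact (mul_right_cancel₀ hT.ne' this).le
  -- The strict cost bound on any one instance already excludes `M = 0`.
  have hM : (0 : ℝ) < M := by
    have h := pos_of_gt (hP (DistMAB.coinBandit hεpos.le h1 ⟨0, by omega⟩))
    rcases Nat.eq_zero_or_pos M with h0 | h0
    · simp [h0] at h
    · exact_mod_cast h0
  by_contra! hcon
  have hlt : ∀ k : Fin K, ε * ∑ i, ∫ ω, P.wrong k i ω
      ∂(P.runLaw (DistMAB.coinBandit hεpos.le h1 k)) ≤ ε * (M * T / 8 + M * T / 3000) := by
    intro k
    rw [P.sum_integral_wrong hεpos.le h1 k]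
    have hr := hcon (DistMAB.coinBandit hεpos.le h1 k)
    -- In these units `M * √(K T) / 128` is `ε * (M * T / 8)`.
    rw [show √((K : ℝ) * T) = 16 * (ε * T) by rw [hεT]; ring] at hr
    have hc := mul_le_mul_of_nonneg_left (P.sum_real_contacted_le _
      (hP (DistMAB.coinBandit hεpos.le h1 k))) (mul_pos hεpos hT).le
    nlinarith
  have hsum := Finset.sum_le_sum fun k (_ : k ∈ Finset.univ) =>
    le_of_mul_le_mul_left (hlt k) hεpos
  have hlow := Finset.sum_le_sum fun i (_ : i ∈ Finset.univ) =>
    P.le_sum_integral_wrong hK hεpos.le h1 hε2 i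
  rw [Finset.sum_comm] at hsum
  have h := hlow.trans hsum
  simp only [Finset.sum_const, Finset.card_univ, Fintype.card_fin, nsmul_eq_mul] at h
  have hMKT : 0 < (M : ℝ) * (K * T) := by positivity
  -- The contradiction is `1/4 ≤ 1/8 + 1/3000`, up to the factor `M * K * T > 0`.
  nlinarith
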